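/- Let $\xi(s)=(s-1)\pi^{-s/2}\Gamma(1+s/2)\zeta(s)$ be Riemann's $\xi$-function and, for $z\in\mathbb C$ and $a>0$, let $E_z(a)=\int_1^\infty t^{-z}e^{-at}\,dt$ be the generalized exponential integral. Then for every complex $s$ with $0<\operatorname{Re}s<1$, $$\xi(s)=2\pi^2\sum_{n=1}^{\infty}\int_1^{\infty}\left(t^{s/2}+t^{(1-s)/2}\right)\left(n^4t-\frac{3}{2\pi}n^2\right)e^{-\pi n^2t}\,dt$$ and $$\xi(s)=\frac{\pi^{1/4}}{2\Gamma(3/4)}-\pi\sum_{n=1}^{\infty}n^2\left[s\,E_{(s-1)/2}(\pi n^2)+(1-s)\,E_{-s/2}(\pi n^2)\right],$$ where all the integrals and both series converge absolutely. Moreover, the constant term in the second formula is the sum of a series: $4\pi\sum_{n=1}^\infty n^2e^{-\pi n^2}=\frac{\pi^{1/4}}{2\Gamma(3/4)}$. -/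

import Mathlib

/-- Riemann's function `ξ(s) = (s - 1) π^{-s/2} Γ(1 + s/2) ζ(s)`. (The formula has a removable
singularity at `s = 1`, which lies outside the open critical strip `0 < Re s < 1`.) -/
noncomputable def riemannXi (s : ℂ) : ℂ :=
  (s - 1) * (Real.pi : ℂ) ^ (-s / 2) * Complex.Gamma (1 + s / 2) * riemannZeta s

/-- The integrand `t^{-z} e^{-a t}` of the generalized exponential integral. -/
noncomputable def expIntegrand (z : ℂ) (a t : ℝ) : ℂ :=
  (t : ℂ) ^ (-z) * (Real.exp (-(a * t)) : ℂ)

/-- The generalized exponential integral `E_z(a) = ∫_1^∞ t^{-z} e^{-a t} dt`. -/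
noncomputable def genExpIntegral (z : ℂ) (a : ℝ) : ℂ :=
  ∫ t in Set.Ioi (1 : ℝ), expIntegrand z a t

/-- The integrand `(t^{s/2} + t^{(1-s)/2}) (n⁴ t - 3 n² / (2π)) e^{-π n² t}`. -/
noncomputable def xiIntegrand (s : ℂ) (n : ℕ) (t : ℝ) : ℂ :=
  ((t : ℂ) ^ (s / 2) + (t : ℂ) ^ ((1 - s) / 2)) *
    (((n : ℝ) ^ 4 * t - 3 / (2 * Real.pi) * (n : ℝ) ^ 2 : ℝ) : ℂ) *
    (Real.exp (-(Real.pi * (n : ℝ) ^ 2 * t)) : ℂ)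

/-!
With `θ₃(t) = ∑ e^{-πn²t}` summed over `ℤ`, Riemann's proof of the functional equation gives
`ξ(s) = 1/2 + s(s-1)/2 · ∑ ∫_1^∞ (t^{s/2-1} + t^{(1-s)/2-1}) e^{-πn²t} dt`, summed over `n ≥ 1`
(`hasSum_completedRiemannZeta₀`, `riemannXi_eq`). One integration by parts in each term
(`genExpIntegral_add_one`) produces the series of exponential integrals, with constant term
`1/2 + ∑ e^{-πn²} = θ₃(1)/2` (`hasSum_sq_mul_genExpIntegral`). A second integration by parts turns
the terms of the first series into `4πn²e^{-πn²}` minus the terms of the second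
(`integral_xiIntegrand`), and `∑ 4πn²e^{-πn²} = θ₃(1)/2`, because differentiating
`θ₃(t) = t^{-1/2} θ₃(1/t)` at `t = 1` gives `θ₃'(1) = -θ₃(1)/4`.

There remains `θ₃(1) = π^{1/4}/Γ(3/4)` (`thetaThree_one`), which is proved through the
arithmetic-geometric mean. Doubling `t` carries `(θ₃², θ₄²)` to its arithmetic and geometric means
(`thetaThree_sq_add_thetaFour_sq`, `thetaThree_mul_thetaFour`), Gauss's substitution shows that
this step preserves `∫_0^∞ dt/√((t²+a²)(t²+b²))` (`ellipticIntegral_agm`), and `θ₃, θ₄ → 1` as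
`t → ∞`; so the integral with `a = θ₃(t)²`, `b = θ₄(t)²` equals `π/2`. At `t = 1` one has
`θ₃(1)² = √2 θ₄(1)²` by inversion, and the integral reduces to the Beta value `B(1/4, 1/2)`.
-/

/-! ### Theta constants -/

/-- The theta constant `θ₃(e^{-πt}) = ∑ e^{-πn²t}`, as a function of the real variable `t`. -/
noncomputable def thetaThree (t : ℝ) : ℝ := ∑' n : ℤ, Real.exp (-Real.pi * n ^ 2 * t)

/-- The theta constant `θ₄(e^{-πt}) = ∑ (-1)ⁿ e^{-πn²t}`, as a function of the real variable `t`. -/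
noncomputable def thetaFour (t : ℝ) : ℝ :=
  ∑' n : ℤ, (-1 : ℝ) ^ n * Real.exp (-Real.pi * n ^ 2 * t)

theorem summable_abs_pow_mul_exp_neg_int_sq (k : ℕ) {t : ℝ} (ht : 0 < t) :
    Summable fun n : ℤ => |(n : ℝ)| ^ k * Real.exp (-Real.pi * n ^ 2 * t) := by
  refine (HurwitzKernelBounds.summable_f_int k 0 ht).congr fun n => ?_
  simp [HurwitzKernelBounds.f_int]

theorem summable_thetaThree {t : ℝ} (ht : 0 < t) :
    Summable fun n : ℤ => Real.exp (-Real.pi * n ^ 2 * t) := by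
  simpa using summable_abs_pow_mul_exp_neg_int_sq 0 ht

theorem summable_thetaFour {t : ℝ} (ht : 0 < t) :
    Summable fun n : ℤ => (-1 : ℝ) ^ n * Real.exp (-Real.pi * n ^ 2 * t) :=
  .of_norm_bounded (summable_thetaThree ht) fun n => by simp

theorem thetaThree_pos {t : ℝ} (ht : 0 < t) : 0 < thetaThree t :=
  (summable_thetaThree ht).tsum_pos (fun _ => (Real.exp_pos _).le) 0 (Real.exp_pos _)

theorem int_add_sub_injective :
    Function.Injective fun p : ℤ × ℤ => (p.1 + p.2, p.1 - p.2) := by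
  rintro ⟨a, b⟩ ⟨c, d⟩ h
  simp only [Prod.mk.injEq] at h ⊢
  omega

theorem mem_range_int_add_sub {m n : ℤ} (h : Even (m + n)) :
    (m, n) ∈ Set.range fun p : ℤ × ℤ => (p.1 + p.2, p.1 - p.2) := by
  obtain ⟨r, hr⟩ := h
  exact ⟨(r, m - r), by simp only [Prod.mk.injEq]; omega⟩

/-- A double series over `ℤ²` supported on the pairs of equal parity, reindexed by
`(m, n) = (a + b, a - b)`. -/
theorem tsum_eq_tsum_int_add_sub {f : ℤ × ℤ → ℝ} (hf : ∀ m n, ¬ Even (m + n) → f (m, n) = 0) :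
    ∑' p, f p = ∑' p : ℤ × ℤ, f (p.1 + p.2, p.1 - p.2) := by
  refine (int_add_sub_injective.tsum_eq (f := f) ?_).symm
  rintro ⟨m, n⟩ h
  refine mem_range_int_add_sub ?_
  by_contra h'
  exact h (hf m n h')

theorem neg_one_zpow_mul_self (n : ℤ) : (-1 : ℝ) ^ n * (-1) ^ n = 1 := by
  rcases Int.even_or_odd n with h | h <;> simp [h.neg_one_zpow]

theorem neg_one_zpow_of_not_even_add {m n : ℤ} (h : ¬ Even (m + n)) :
    (-1 : ℝ) ^ m = -(-1) ^ n := by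
  have h1 := (Int.not_even_iff_odd.mp h).neg_one_zpow (α := ℝ)
  rw [zpow_add₀ (by norm_num)] at h1
  linear_combination (-1 : ℝ) ^ n * h1 - (-1 : ℝ) ^ m * neg_one_zpow_mul_self n

theorem exp_neg_int_sq_add_sub (a b : ℤ) (t : ℝ) :
    Real.exp (-Real.pi * ((a + b : ℤ) : ℝ) ^ 2 * t) *
        Real.exp (-Real.pi * ((a - b : ℤ) : ℝ) ^ 2 * t)
      = Real.exp (-Real.pi * a ^ 2 * (2 * t)) * Real.exp (-Real.pi * b ^ 2 * (2 * t)) := by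
  rw [← Real.exp_add, ← Real.exp_add]
  push_cast
  ring_nf

theorem summable_mul_int_prod {f g : ℤ → ℝ} (hf : Summable f) (hg : Summable g) :
    Summable fun p : ℤ × ℤ => f p.1 * g p.2 :=
  summable_mul_of_summable_norm hf.norm hg.norm

theorem tsum_mul_tsum_int {f g : ℤ → ℝ} (hf : Summable f) (hg : Summable g) :
    (∑' n, f n) * ∑' n, g n = ∑' p : ℤ × ℤ, f p.1 * g p.2 :=
  hf.tsum_mul_tsum hg (summable_mul_int_prod hf hg)

/-- The arithmetic-mean half of the AGM step for theta constants. -/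
theorem thetaThree_sq_add_thetaFour_sq {t : ℝ} (ht : 0 < t) :
    thetaThree t ^ 2 + thetaFour t ^ 2 = 2 * thetaThree (2 * t) ^ 2 := by
  have h3 := summable_thetaThree ht
  have h4 := summable_thetaFour ht
  have h3' := summable_thetaThree (t := 2 * t) (by positivity)
  simp only [sq (thetaThree _), sq (thetaFour _)]
  rw [thetaThree, thetaFour, thetaThree, tsum_mul_tsum_int h3 h3, tsum_mul_tsum_int h4 h4,
    tsum_mul_tsum_int h3' h3',
    ← (summable_mul_int_prod h3 h3).tsum_add (summable_mul_int_prod h4 h4),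
    tsum_eq_tsum_int_add_sub, ← tsum_mul_left]
  · refine tsum_congr fun p => ?_
    have h : (-1 : ℝ) ^ (p.1 + p.2) * (-1) ^ (p.1 - p.2) = 1 := by
      rw [← zpow_add₀ (by norm_num)]
      exact Even.neg_one_zpow ⟨p.1, by ring⟩
    rw [← exp_neg_int_sq_add_sub]
    linear_combination (Real.exp (-Real.pi * ((p.1 + p.2 : ℤ) : ℝ) ^ 2 * t) *
      Real.exp (-Real.pi * ((p.1 - p.2 : ℤ) : ℝ) ^ 2 * t)) * h
  · intro m n h
    simp only
    rw [neg_one_zpow_of_not_even_add h]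
    linear_combination -(Real.exp (-Real.pi * m ^ 2 * t) * Real.exp (-Real.pi * n ^ 2 * t)) *
      neg_one_zpow_mul_self n

/-- The geometric-mean half of the AGM step for theta constants. -/
theorem thetaThree_mul_thetaFour {t : ℝ} (ht : 0 < t) :
    thetaThree t * thetaFour t = thetaFour (2 * t) ^ 2 := by
  have h3 := summable_thetaThree ht
  have h4 := summable_thetaFour ht
  have h4' := summable_thetaFour (t := 2 * t) (by positivity)
  -- symmetrizing in the two summation variables kills the pairs of opposite parity
  suffices h : thetaThree t * thetaFour t + thetaFour t * thetaThree t
      = 2 * (thetaFour (2 * t) * thetaFour (2 * t)) by linarith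
  rw [thetaThree, thetaFour, thetaFour, tsum_mul_tsum_int h3 h4, tsum_mul_tsum_int h4 h3,
    tsum_mul_tsum_int h4' h4',
    ← (summable_mul_int_prod h3 h4).tsum_add (summable_mul_int_prod h4 h3),
    tsum_eq_tsum_int_add_sub, ← tsum_mul_left]
  · refine tsum_congr fun p => ?_
    have h (a b : ℤ) : (-1 : ℝ) ^ (a + b) = (-1) ^ a * (-1) ^ b := zpow_add₀ (by norm_num) a b
    have h' : (-1 : ℝ) ^ (p.1 - p.2) = (-1) ^ p.1 * (-1) ^ p.2 := by
      rw [← h, show p.1 + p.2 = p.1 - p.2 + 2 * p.2 by ring, h, (even_two_mul _).neg_one_zpow,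
        mul_one]
    simp only [h, h']
    linear_combination 2 * ((-1 : ℝ) ^ p.1 * (-1) ^ p.2) * exp_neg_int_sq_add_sub p.1 p.2 t
  · intro m n h
    simp only
    rw [neg_one_zpow_of_not_even_add h]
    ring

/-- Jacobi's inversion formula for the theta constant. -/
theorem thetaThree_inversion {t : ℝ} (ht : 0 < t) :
    thetaThree t = 1 / t ^ (1 / 2 : ℝ) * thetaThree t⁻¹ := by
  have h := Real.tsum_exp_neg_mul_int_sq ht
  simp only [thetaThree]
  convert h using 4
  · ring_nf
  · ring_nf

/-- The ratio of the squared theta constants at `t = 1`: the inversion formula ties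
`t = 1 / 2` to `t = 2`, and two AGM steps lead from one to the other. -/
theorem thetaThree_one_pow_four : (thetaThree 1 ^ 2) ^ 2 = 2 * (thetaFour 1 ^ 2) ^ 2 := by
  have h1 := thetaThree_sq_add_thetaFour_sq (t := 1) one_pos
  have h2 := thetaThree_sq_add_thetaFour_sq (t := 1 / 2) (by norm_num)
  have h3 := thetaThree_mul_thetaFour (t := 1 / 2) (by norm_num)
  have h4 : thetaThree (1 / 2) ^ 2 = 2 * thetaThree 2 ^ 2 := by
    rw [thetaThree_inversion (by norm_num : (0 : ℝ) < 1 / 2), mul_pow, div_pow, ← Real.sqrt_eq_rpow,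
      Real.sq_sqrt (by norm_num)]
    norm_num
  norm_num at h1 h2 h3 h4
  have h5 : thetaThree (1 / 2) ^ 2 * thetaFour (1 / 2) ^ 2 = (thetaFour 1 ^ 2) ^ 2 := by
    rw [← mul_pow, h3]
  have h6 : thetaThree (1 / 2) ^ 2 = thetaThree 1 ^ 2 + thetaFour 1 ^ 2 := by linarith
  have h7 : thetaFour (1 / 2) ^ 2 = thetaThree 1 ^ 2 - thetaFour 1 ^ 2 := by linarith
  rw [h6, h7] at h5
  linarith

/-- Dominated convergence for the theta series as `t → ∞`: only the term `n = 0` survives. -/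
theorem tendsto_tsum_mul_exp_neg_int_sq {c : ℤ → ℝ} (hc : ∀ n, |c n| ≤ 1) :
    Filter.Tendsto (fun t : ℝ => ∑' n : ℤ, c n * Real.exp (-Real.pi * n ^ 2 * t)) Filter.atTop
      (nhds (c 0)) := by
  rw [← tsum_ite_eq (0 : ℤ) (fun n => c n)]
  refine tendsto_tsum_of_dominated_convergence (summable_thetaThree one_pos) (fun n => ?_) ?_
  · split_ifs with h
    · simp [h]
    · rw [← mul_zero (c n)]
      refine Filter.Tendsto.const_mul _ (Real.tendsto_exp_atBot.comp ?_)
      refine Filter.Tendsto.const_mul_atTop_of_neg ?_ Filter.tendsto_id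
      have : (0 : ℝ) < (n : ℝ) ^ 2 := by positivity
      nlinarith [Real.pi_pos]
  · filter_upwards [Filter.eventually_ge_atTop 1] with t ht n
    rw [Real.norm_eq_abs, abs_mul, Real.abs_exp]
    refine (mul_le_of_le_one_left (Real.exp_pos _).le (hc n)).trans (Real.exp_le_exp.mpr ?_)
    refine mul_le_mul_of_nonpos_left ht ?_
    nlinarith [Real.pi_pos, sq_nonneg (n : ℝ)]

theorem tendsto_thetaThree : Filter.Tendsto thetaThree Filter.atTop (nhds 1) := by
  have h := tendsto_tsum_mul_exp_neg_int_sq (c := fun _ => 1) (by simp)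
  simpa only [one_mul] using! h

theorem tendsto_thetaFour : Filter.Tendsto thetaFour Filter.atTop (nhds 1) := by
  have h := tendsto_tsum_mul_exp_neg_int_sq (c := fun n => (-1) ^ n) (by simp)
  simpa only [zpow_zero] using! h

theorem tendsto_two_pow_mul {t : ℝ} (ht : 0 < t) :
    Filter.Tendsto (fun k : ℕ => 2 ^ k * t) Filter.atTop Filter.atTop :=
  (tendsto_pow_atTop_atTop_of_one_lt one_lt_two).atTop_mul_const ht

/-- A zero at `t` would propagate along `2ᵏt` by the geometric-mean step, against the limit `1`. -/
theorem thetaFour_ne_zero {t : ℝ} (ht : 0 < t) : thetaFour t ≠ 0 := by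
  intro h
  have h0 (k : ℕ) : thetaFour (2 ^ k * t) = 0 := by
    induction k with
    | zero => simpa using h
    | succ k ih =>
      have := thetaThree_mul_thetaFour (t := 2 ^ k * t) (by positivity)
      rw [ih, mul_zero] at this
      rw [pow_succ', mul_assoc]
      exact pow_eq_zero_iff two_ne_zero |>.mp this.symm
  have := tendsto_thetaFour.comp (tendsto_two_pow_mul ht)
  simp only [Function.comp_def, h0] at this
  exact zero_ne_one (tendsto_nhds_unique tendsto_const_nhds this)

/-! ### The arithmetic-geometric mean and the complete elliptic integral -/

/-- The complete elliptic integral `∫_0^∞ dt / √((t² + a²)(t² + b²))`. -/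
noncomputable def ellipticIntegral (a b : ℝ) : ℝ :=
  ∫ t in Set.Ioi (0 : ℝ), 1 / Real.sqrt ((t ^ 2 + a ^ 2) * (t ^ 2 + b ^ 2))

theorem gauss_subst_image {c : ℝ} (hc : 0 < c) :
    (fun t : ℝ => (t - c / t) / 2) '' Set.Ioi 0 = Set.univ := by
  refine Set.eq_univ_of_forall fun u => ?_
  have h1 : 0 < u ^ 2 + c := by positivity
  have h2 := Real.sq_sqrt h1.le
  have h3 : 0 < u + Real.sqrt (u ^ 2 + c) := by
    have : |u| < Real.sqrt (u ^ 2 + c) := Real.lt_sqrt_of_sq_lt (by rw [sq_abs]; linarith)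
    linarith [neg_abs_le u]
  refine ⟨u + Real.sqrt (u ^ 2 + c), h3, ?_⟩
  have h4 : c / (u + Real.sqrt (u ^ 2 + c)) = Real.sqrt (u ^ 2 + c) - u := by
    rw [div_eq_iff h3.ne']
    linear_combination -h2
  simp only [h4]
  ring

theorem gauss_subst_injOn {c : ℝ} (hc : 0 < c) :
    Set.InjOn (fun t : ℝ => (t - c / t) / 2) (Set.Ioi 0) := by
  intro x (hx : 0 < x) y (hy : 0 < y) h
  simp only at h
  field_simp at h
  have h0 : (x - y) * (x * y + c) = 0 := by linear_combination h
  rcases mul_eq_zero.mp h0 with h | h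
  · linarith
  · nlinarith [mul_pos hx hy]

/-- Gauss's transformation: the elliptic integral is invariant under the AGM step. The
substitution is `u = (t - ab/t) / 2`, which maps `(0, ∞)` onto the whole line. -/
theorem ellipticIntegral_agm {a b g : ℝ} (ha : 0 < a) (hb : 0 < b) (hg : g ^ 2 = a * b) :
    ellipticIntegral ((a + b) / 2) g = ellipticIntegral a b := by
  have hc : 0 < a * b := mul_pos ha hb
  set F : ℝ → ℝ := fun u => 1 / Real.sqrt ((u ^ 2 + ((a + b) / 2) ^ 2) * (u ^ 2 + g ^ 2)) with hF
  have h1 : ∫ u, F u = 2 * ellipticIntegral ((a + b) / 2) g := by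
    rw [ellipticIntegral, ← integral_comp_abs]
    simp [hF, sq_abs]
  have hd : ∀ t ∈ Set.Ioi (0 : ℝ), HasDerivWithinAt (fun t : ℝ => (t - a * b / t) / 2)
      ((1 + a * b / t ^ 2) / 2) (Set.Ioi 0) t := by
    intro t (ht : 0 < t)
    refine HasDerivAt.hasDerivWithinAt ?_
    refine (((hasDerivAt_id' t).fun_sub ((hasDerivAt_inv ht.ne').const_mul (a * b))).div_const
      2).congr_deriv ?_
    ring
  have h2 := MeasureTheory.integral_image_eq_integral_abs_deriv_smul measurableSet_Ioi hd
    (gauss_subst_injOn hc) F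
  rw [gauss_subst_image hc, MeasureTheory.setIntegral_univ, h1] at h2
  have h3 : ∫ t in Set.Ioi (0 : ℝ), |(1 + a * b / t ^ 2) / 2| • F ((t - a * b / t) / 2)
      = 2 * ellipticIntegral a b := by
    rw [ellipticIntegral, ← MeasureTheory.integral_const_mul]
    refine MeasureTheory.setIntegral_congr_fun measurableSet_Ioi fun t (ht : 0 < t) => ?_
    have e : (((t - a * b / t) / 2) ^ 2 + ((a + b) / 2) ^ 2) * (((t - a * b / t) / 2) ^ 2 + g ^ 2)
        = ((1 + a * b / t ^ 2) / 4) ^ 2 * ((t ^ 2 + a ^ 2) * (t ^ 2 + b ^ 2)) := by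
      rw [hg]
      field_simp
      ring
    have p : 0 < 1 + a * b / t ^ 2 := by positivity
    simp only [hF, smul_eq_mul]
    rw [e, Real.sqrt_mul (sq_nonneg _), Real.sqrt_sq (by positivity), abs_of_pos (by positivity)]
    have : 0 < Real.sqrt ((t ^ 2 + a ^ 2) * (t ^ 2 + b ^ 2)) := by positivity
    field_simp
    norm_num
  linarith

theorem ellipticIntegral_one_one : ellipticIntegral 1 1 = Real.pi / 2 := by
  have h := integral_Ioi_inv_one_add_sq (i := 0)
  rw [Real.arctan_zero, sub_zero] at h
  rw [ellipticIntegral, ← h]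
  refine MeasureTheory.setIntegral_congr_fun measurableSet_Ioi fun t _ => ?_
  rw [Real.sqrt_mul_self (by positivity), one_div, one_pow, add_comm]

theorem tendsto_ellipticIntegral {a b : ℕ → ℝ} (ha : Filter.Tendsto a Filter.atTop (nhds 1))
    (hb : Filter.Tendsto b Filter.atTop (nhds 1)) :
    Filter.Tendsto (fun k => ellipticIntegral (a k) (b k)) Filter.atTop (nhds (Real.pi / 2)) := by
  rw [← ellipticIntegral_one_one]
  refine MeasureTheory.tendsto_integral_filter_of_dominated_convergence
    (fun t => 4 * (1 + t ^ 2)⁻¹) ?_ ?_ ?_ ?_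
  · refine .of_forall fun k => Measurable.aestronglyMeasurable ?_
    fun_prop
  · filter_upwards [ha.eventually (lt_mem_nhds (show (1 / 2 : ℝ) < 1 by norm_num)),
      hb.eventually (lt_mem_nhds (show (1 / 2 : ℝ) < 1 by norm_num))] with k hak hbk
    refine .of_forall fun t => ?_
    rw [Real.norm_of_nonneg (by positivity), ← div_eq_mul_inv, div_le_div_iff₀ (by positivity)
      (by positivity), one_mul]
    have h1 : (1 + t ^ 2) / 4 ≤ t ^ 2 + a k ^ 2 := by nlinarith [sq_nonneg t]
    have h2 : (1 + t ^ 2) / 4 ≤ t ^ 2 + b k ^ 2 := by nlinarith [sq_nonneg t]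
    have h3 : (1 + t ^ 2) / 4 ≤ Real.sqrt ((t ^ 2 + a k ^ 2) * (t ^ 2 + b k ^ 2)) := by
      refine Real.le_sqrt_of_sq_le ?_
      rw [sq]
      gcongr
    linarith
  · exact (integrable_inv_one_add_sq.const_mul 4).integrableOn
  · refine .of_forall fun t => ?_
    refine Filter.Tendsto.div tendsto_const_nhds (Filter.Tendsto.sqrt ?_) (by positivity)
    exact (tendsto_const_nhds.add (ha.pow 2)).mul (tendsto_const_nhds.add (hb.pow 2))

theorem ellipticIntegral_mul {a b c : ℝ} (hc : 0 < c) :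
    c * ellipticIntegral (c * a) (c * b) = ellipticIntegral a b := by
  have h := MeasureTheory.integral_comp_mul_left_Ioi
    (fun t : ℝ => 1 / Real.sqrt ((t ^ 2 + (c * a) ^ 2) * (t ^ 2 + (c * b) ^ 2))) 0 hc
  rw [mul_zero, smul_eq_mul, eq_inv_mul_iff_mul_eq₀ hc.ne'] at h
  rw [ellipticIntegral, ← h, ellipticIntegral, ← MeasureTheory.integral_const_mul,
    ← MeasureTheory.integral_const_mul]
  refine MeasureTheory.setIntegral_congr_fun measurableSet_Ioi fun t (ht : 0 < t) => ?_
  have e : ((c * t) ^ 2 + (c * a) ^ 2) * ((c * t) ^ 2 + (c * b) ^ 2)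
      = (c ^ 2) ^ 2 * ((t ^ 2 + a ^ 2) * (t ^ 2 + b ^ 2)) := by ring
  rw [e, Real.sqrt_mul (sq_nonneg _), Real.sqrt_sq (by positivity)]
  have : 0 < Real.sqrt ((t ^ 2 + a ^ 2) * (t ^ 2 + b ^ 2)) := by positivity
  field_simp

theorem integral_Ioo_rpow_mul_one_sub_rpow {u v : ℝ} (hu : 0 < u) (hv : 0 < v) :
    ∫ x in Set.Ioo (0 : ℝ) 1, x ^ (u - 1) * (1 - x) ^ (v - 1)
      = Real.Gamma u * Real.Gamma v / Real.Gamma (u + v) := by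
  have h := Complex.betaIntegral_eq_Gamma_mul_div u v (by simpa) (by simpa)
  rw [Complex.betaIntegral, intervalIntegral.integral_of_le zero_le_one,
    MeasureTheory.integral_Ioc_eq_integral_Ioo, ← Complex.ofReal_add, Complex.Gamma_ofReal,
    Complex.Gamma_ofReal, Complex.Gamma_ofReal] at h
  apply Complex.ofReal_injective
  push_cast
  rw [← h, ← integral_complex_ofReal]
  refine MeasureTheory.setIntegral_congr_fun measurableSet_Ioo fun x hx => ?_
  rw [Complex.ofReal_mul, Complex.ofReal_cpow hx.1.le, Complex.ofReal_cpow (by linarith [hx.2])]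
  push_cast
  rfl

theorem lemniscate_subst_image :
    (fun t : ℝ => ((1 + t ^ 2) ^ 2)⁻¹) '' Set.Ioi 0 = Set.Ioo 0 1 := by
  ext x
  constructor
  · rintro ⟨t, ht, rfl⟩
    have ht : 0 < t := ht
    exact ⟨by positivity, inv_lt_one_of_one_lt₀ (by nlinarith [sq_pos_of_pos ht])⟩
  · rintro ⟨h0, h1⟩
    have h2 : 1 < Real.sqrt x⁻¹ := Real.lt_sqrt_of_sq_lt (by
      rw [one_pow]; exact (one_lt_inv₀ h0).mpr h1)
    refine ⟨Real.sqrt (Real.sqrt x⁻¹ - 1), Real.sqrt_pos.mpr (by linarith), ?_⟩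
    simp only
    rw [Real.sq_sqrt (by linarith), add_sub_cancel, Real.sq_sqrt (by positivity), inv_inv]

theorem lemniscate_subst_injOn :
    Set.InjOn (fun t : ℝ => ((1 + t ^ 2) ^ 2)⁻¹) (Set.Ioi 0) := by
  intro x (hx : 0 < x) y (hy : 0 < y) h
  have h1 := inv_injective h
  have h2 := (pow_left_inj₀ (by positivity) (by positivity) two_ne_zero).mp h1
  exact (pow_left_inj₀ hx.le hy.le two_ne_zero).mp (by linarith)

/-- The lemniscatic case, by the substitution `x = (1 + t²)⁻²` in the Beta integral. -/
theorem four_mul_ellipticIntegral_sqrt_two_one :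
    4 * ellipticIntegral (Real.sqrt 2) 1
      = Real.Gamma (1 / 4) * Real.Gamma (1 / 2) / Real.Gamma (3 / 4) := by
  have hd : ∀ t ∈ Set.Ioi (0 : ℝ), HasDerivWithinAt (fun t : ℝ => ((1 + t ^ 2) ^ 2)⁻¹)
      (-(4 * t / (1 + t ^ 2) ^ 3)) (Set.Ioi 0) t := by
    intro t (ht : 0 < t)
    refine HasDerivAt.hasDerivWithinAt ?_
    refine ((((hasDerivAt_id' t).fun_pow 2).const_add 1).fun_pow 2).fun_inv
      (by positivity) |>.congr_deriv ?_
    push_cast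
    field_simp
    norm_num
  have h := MeasureTheory.integral_image_eq_integral_abs_deriv_smul measurableSet_Ioi hd
    lemniscate_subst_injOn (fun x : ℝ => x ^ ((1 / 4 : ℝ) - 1) * (1 - x) ^ ((1 / 2 : ℝ) - 1))
  rw [lemniscate_subst_image, integral_Ioo_rpow_mul_one_sub_rpow (by norm_num) (by norm_num)] at h
  rw [show (3 / 4 : ℝ) = 1 / 4 + 1 / 2 by norm_num, h, ellipticIntegral,
    ← MeasureTheory.integral_const_mul]
  refine MeasureTheory.setIntegral_congr_fun measurableSet_Ioi fun t (ht : 0 < t) => ?_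
  have hp : 0 < 1 + t ^ 2 := by positivity
  have e0 : (((1 + t ^ 2) ^ 2)⁻¹ : ℝ) ^ ((1 / 4 : ℝ) - 1)
      = (1 + t ^ 2) * Real.sqrt (1 + t ^ 2) := by
    rw [Real.inv_rpow (by positivity), ← Real.rpow_neg (by positivity), ← Real.rpow_natCast,
      ← Real.rpow_mul hp.le, Real.sqrt_eq_rpow]
    nth_rewrite 2 [← Real.rpow_one (1 + t ^ 2)]
    rw [← Real.rpow_add hp]
    norm_num
  have e1 : 1 - ((1 + t ^ 2) ^ 2)⁻¹ = (t / (1 + t ^ 2)) ^ 2 * (t ^ 2 + 2) := by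
    field_simp
    ring
  have e2 : (1 - ((1 + t ^ 2) ^ 2)⁻¹) ^ ((1 / 2 : ℝ) - 1)
      = (t / (1 + t ^ 2) * Real.sqrt (t ^ 2 + 2))⁻¹ := by
    rw [show (1 / 2 : ℝ) - 1 = -(1 / 2) by norm_num, e1, Real.rpow_neg (by positivity),
      ← Real.sqrt_eq_rpow, Real.sqrt_mul (sq_nonneg _), Real.sqrt_sq (by positivity)]
  simp only [smul_eq_mul]
  rw [e0, e2, Real.sq_sqrt zero_le_two, one_pow, abs_neg, abs_of_pos (by positivity),
    Real.sqrt_mul (by positivity), add_comm (t ^ 2) 1]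
  have h1 := Real.sq_sqrt hp.le
  have h2 : 0 < Real.sqrt (1 + t ^ 2) := by positivity
  field_simp
  linear_combination -h1

/-! ### The value of the theta constant at `t = 1` -/

/-- The AGM step `(θ₃²(t), θ₄²(t)) ↦ (θ₃²(2t), θ₄²(2t))` preserves the elliptic integral, and the
pair tends to `(1, 1)`: the arithmetic-geometric mean of `θ₃²(t)` and `θ₄²(t)` is `1`. -/
theorem ellipticIntegral_theta {t : ℝ} (ht : 0 < t) :
    ellipticIntegral (thetaThree t ^ 2) (thetaFour t ^ 2) = Real.pi / 2 := by
  have hstep {t : ℝ} (ht : 0 < t) :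
      ellipticIntegral (thetaThree (2 * t) ^ 2) (thetaFour (2 * t) ^ 2)
        = ellipticIntegral (thetaThree t ^ 2) (thetaFour t ^ 2) := by
    rw [← ellipticIntegral_agm (g := thetaFour (2 * t) ^ 2) (pow_pos (thetaThree_pos ht) 2)
      (sq_pos_of_ne_zero (thetaFour_ne_zero ht)), thetaThree_sq_add_thetaFour_sq ht,
      mul_div_cancel_left₀ _ two_ne_zero]
    rw [← thetaThree_mul_thetaFour ht, mul_pow]
  have hconst (k : ℕ) : ellipticIntegral (thetaThree (2 ^ k * t) ^ 2) (thetaFour (2 ^ k * t) ^ 2)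
      = ellipticIntegral (thetaThree t ^ 2) (thetaFour t ^ 2) := by
    induction k with
    | zero => simp
    | succ k ih => rw [← ih, ← hstep (t := 2 ^ k * t) (by positivity), pow_succ' (2 : ℝ), mul_assoc]
  have h3 := (tendsto_thetaThree.comp (tendsto_two_pow_mul ht)).pow 2
  have h4 := (tendsto_thetaFour.comp (tendsto_two_pow_mul ht)).pow 2
  rw [one_pow] at h3 h4
  have h := tendsto_ellipticIntegral h3 h4
  simp only [Function.comp_def, hconst] at h
  exact tendsto_nhds_unique tendsto_const_nhds h

/-- `∑ e^{-πn²} = π^{1/4} / Γ(3/4)`. -/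
theorem thetaThree_one : thetaThree 1 = Real.pi ^ (1 / 4 : ℝ) / Real.Gamma (3 / 4) := by
  have hB : 0 < thetaFour 1 ^ 2 := sq_pos_of_ne_zero (thetaFour_ne_zero one_pos)
  have hA : thetaThree 1 ^ 2 = thetaFour 1 ^ 2 * Real.sqrt 2 := by
    refine (pow_left_inj₀ (by positivity) (by positivity) two_ne_zero).mp ?_
    rw [thetaThree_one_pow_four, mul_pow, Real.sq_sqrt zero_le_two, mul_comm]
  have h1 := ellipticIntegral_mul (a := Real.sqrt 2) (b := 1) hB
  rw [mul_one, ← hA, ellipticIntegral_theta one_pos] at h1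
  have h2 := four_mul_ellipticIntegral_sqrt_two_one
  rw [← h1, Real.Gamma_one_half_eq] at h2
  have hG : 0 < Real.Gamma (3 / 4) := Real.Gamma_pos_of_pos (by norm_num)
  have h3 := Real.Gamma_mul_Gamma_one_sub (1 / 4)
  rw [show (1 : ℝ) - 1 / 4 = 3 / 4 by norm_num, mul_one_div, Real.sin_pi_div_four] at h3
  have hs := Real.sq_sqrt (zero_le_two (α := ℝ))
  have hs' : 0 < Real.sqrt 2 := by positivity
  have hpi := Real.sq_sqrt Real.pi_pos.le
  have hpi' : 0 < Real.sqrt Real.pi := by positivity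
  have h4 : thetaThree 1 ^ 2 = Real.sqrt Real.pi / Real.Gamma (3 / 4) ^ 2 := by
    have h5 : Real.Gamma (1 / 4) * Real.Gamma (3 / 4) = Real.pi * Real.sqrt 2 := by
      rw [h3]
      field_simp
      linear_combination -hs
    rw [eq_div_iff (by positivity)] at h2 ⊢
    have h6 : 2 * (thetaFour 1 ^ 2 * Real.sqrt 2 * Real.Gamma (3 / 4) ^ 2) * Real.pi
        = 2 * Real.sqrt Real.pi * Real.pi := by
      linear_combination (Real.sqrt 2 * Real.Gamma (3 / 4)) * h2
        + Real.sqrt 2 * Real.sqrt Real.pi * h5 + Real.pi * Real.sqrt Real.pi * hs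
    rw [hA]
    have := mul_right_cancel₀ Real.pi_ne_zero h6
    linarith
  refine (pow_left_inj₀ (thetaThree_pos one_pos).le (by positivity) two_ne_zero).mp ?_
  rw [h4, div_pow, Real.sqrt_eq_rpow, ← Real.rpow_natCast (_ ^ _), ← Real.rpow_mul Real.pi_pos.le]
  norm_num

/-! ### The derivative of the theta constant -/

theorem hasDerivAt_thetaThree {t : ℝ} (ht : 0 < t) :
    HasDerivAt thetaThree
      (∑' n : ℤ, -Real.pi * n ^ 2 * Real.exp (-Real.pi * n ^ 2 * t)) t := by
  have hs := (summable_abs_pow_mul_exp_neg_int_sq 2 (half_pos ht)).mul_left Real.pi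
  refine hasDerivAt_tsum_of_isPreconnected hs isOpen_Ioi isPreconnected_Ioi
    (t := Set.Ioi (t / 2)) (g := fun (n : ℤ) t => Real.exp (-Real.pi * n ^ 2 * t))
    (g' := fun (n : ℤ) t => -Real.pi * n ^ 2 * Real.exp (-Real.pi * n ^ 2 * t)) (y₀ := t)
    ?_ ?_ (half_lt_self ht) (summable_thetaThree ht) (half_lt_self ht)
  · intro n y _
    refine ((hasDerivAt_id' y).const_mul (-Real.pi * (n : ℝ) ^ 2)).exp.congr_deriv ?_
    ring
  · intro n y (hy : t / 2 < y)
    rw [norm_mul, norm_mul, norm_neg, Real.norm_of_nonneg Real.pi_pos.le, norm_pow,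
      Real.norm_eq_abs, Real.norm_eq_abs, Real.abs_exp, mul_assoc]
    have h : Real.exp (-Real.pi * n ^ 2 * y) ≤ Real.exp (-Real.pi * n ^ 2 * (t / 2)) :=
      Real.exp_le_exp.mpr (mul_le_mul_of_nonpos_left hy.le (by
        nlinarith [mul_nonneg Real.pi_pos.le (sq_nonneg (n : ℝ))]))
    gcongr

/-- Differentiating the inversion formula at its fixed point gives `θ₃'(1) = -θ₃(1) / 4`. -/
theorem tsum_int_sq_mul_exp_neg_int_sq :
    ∑' n : ℤ, -Real.pi * n ^ 2 * Real.exp (-Real.pi * n ^ 2 * (1 : ℝ)) = -thetaThree 1 / 4 := by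
  have h := hasDerivAt_thetaThree one_pos
  set D := ∑' n : ℤ, -Real.pi * n ^ 2 * Real.exp (-Real.pi * n ^ 2 * (1 : ℝ))
  have h1 : HasDerivAt (fun t : ℝ => thetaThree t⁻¹) (-D) 1 := by
    have h' : HasDerivAt thetaThree D (1 : ℝ)⁻¹ := by rwa [inv_one]
    refine (h'.comp (1 : ℝ) (hasDerivAt_inv one_ne_zero)).congr_deriv ?_
    norm_num
  have h2 : HasDerivAt (fun t : ℝ => t ^ (-(1 / 2) : ℝ)) (-(1 / 2)) 1 := by
    refine (Real.hasDerivAt_rpow_const (Or.inl one_ne_zero)).congr_deriv ?_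
    norm_num
  have h3 := h2.fun_mul h1
  have h4 := h.unique (h3.congr_of_eventuallyEq ?_)
  · rw [inv_one, Real.one_rpow] at h4
    linarith
  · filter_upwards [lt_mem_nhds (zero_lt_one (α := ℝ))] with t ht
    rw [thetaThree_inversion ht, Real.rpow_neg (le_of_lt ht), one_div]

/-- The positive half of a theta series. -/
theorem hasSum_pnat_exp_neg_sq {t : ℝ} (ht : 0 < t) :
    HasSum (fun n : ℕ+ => Real.exp (-(Real.pi * (n : ℝ) ^ 2 * t))) ((thetaThree t - 1) / 2) := by
  have hs := summable_thetaThree ht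
  have h := tsum_int_eq_zero_add_two_mul_tsum_pnat (fun n => by simp) hs
  have hp : Summable fun n : ℕ+ => Real.exp (-(Real.pi * (n : ℝ) ^ 2 * t)) := by
    refine (hs.comp_injective (i := fun n : ℕ+ => ((n : ℕ) : ℤ)) ?_).congr fun n => by
      simp
    exact fun m n h => PNat.coe_injective (Int.ofNat_injective h)
  have e : ∑' n : ℕ+, Real.exp (-Real.pi * ((n : ℕ) : ℤ) ^ 2 * t)
      = ∑' n : ℕ+, Real.exp (-(Real.pi * (n : ℝ) ^ 2 * t)) := tsum_congr fun n => by simp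
  rw [e] at h
  convert hp.hasSum using 1
  rw [thetaThree, h]
  simp

theorem summable_pnat_sq_mul_exp_neg_sq {t : ℝ} (ht : 0 < t) :
    Summable fun n : ℕ+ => (n : ℝ) ^ 2 * Real.exp (-(Real.pi * (n : ℝ) ^ 2 * t)) := by
  refine ((summable_abs_pow_mul_exp_neg_int_sq 2 ht).comp_injective
    (i := fun n : ℕ+ => ((n : ℕ) : ℤ)) ?_).congr fun n => by simp
  exact fun m n h => PNat.coe_injective (Int.ofNat_injective h)

/-- The constant term of the second series, from the derivative of the theta constant at `1`. -/
theorem hasSum_four_pi_mul_sq_mul_exp :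
    HasSum (fun n : ℕ+ => 4 * Real.pi * ((n : ℝ) ^ 2 * Real.exp (-(Real.pi * (n : ℝ) ^ 2))))
      (thetaThree 1 / 2) := by
  have hp := summable_pnat_sq_mul_exp_neg_sq one_pos
  simp only [mul_one] at hp
  have hs : Summable fun n : ℤ => -Real.pi * n ^ 2 * Real.exp (-Real.pi * n ^ 2 * (1 : ℝ)) :=
    ((summable_abs_pow_mul_exp_neg_int_sq 2 one_pos).mul_left (-Real.pi)).congr fun n => by
      rw [sq_abs, ← mul_assoc]
  have h := tsum_int_eq_zero_add_two_mul_tsum_pnat (fun n => by simp) hs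
  rw [tsum_int_sq_mul_exp_neg_int_sq] at h
  refine (hp.mul_left (4 * Real.pi)).hasSum_iff.mpr ?_
  have e : ∑' n : ℕ+, -Real.pi * ((n : ℕ) : ℤ) ^ 2 *
        Real.exp (-Real.pi * ((n : ℕ) : ℤ) ^ 2 * (1 : ℝ))
      = -Real.pi * ∑' n : ℕ+, (n : ℝ) ^ 2 * Real.exp (-(Real.pi * (n : ℝ) ^ 2)) := by
    rw [← tsum_mul_left]
    exact tsum_congr fun n => by simp [mul_assoc]
  rw [e] at h
  rw [tsum_mul_left]
  norm_num at h
  linarith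

/-! ### The generalized exponential integral -/

theorem continuousOn_expIntegrand (z : ℂ) (a : ℝ) :
    ContinuousOn (expIntegrand z a) (Set.Ici 1) := by
  intro t (ht : 1 ≤ t)
  have : (t : ℂ) ∈ Complex.slitPlane := Complex.ofReal_mem_slitPlane.mpr (by linarith)
  unfold expIntegrand
  exact ContinuousAt.continuousWithinAt (by fun_prop (disch := assumption))

theorem norm_expIntegrand (z : ℂ) (a : ℝ) {t : ℝ} (ht : 0 < t) :
    ‖expIntegrand z a t‖ = t ^ (-z.re) * Real.exp (-(a * t)) := by
  rw [expIntegrand, norm_mul, Complex.norm_cpow_eq_rpow_re_of_pos ht, Complex.norm_real,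
    Real.norm_eq_abs, Real.abs_exp, Complex.neg_re]

theorem integrableOn_expIntegrand (z : ℂ) {a : ℝ} (ha : 0 < a) :
    MeasureTheory.IntegrableOn (expIntegrand z a) (Set.Ioi 1) := by
  have hm := (continuousOn_expIntegrand z a).mono Set.Ioi_subset_Ici_self
  refine (MeasureTheory.integrable_norm_iff (hm.aestronglyMeasurable measurableSet_Ioi)).mp ?_
  refine integrable_of_isBigO_exp_neg (half_pos ha) (continuousOn_expIntegrand z a).norm ?_
  have h := (isLittleO_rpow_exp_pos_mul_atTop (-z.re) (half_pos ha)).isBigO.mul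
    (Asymptotics.isBigO_refl (fun t : ℝ => Real.exp (-(a * t))) Filter.atTop)
  refine h.congr' ?_ (.of_forall fun t => ?_)
  · filter_upwards [Filter.eventually_gt_atTop 0] with t ht
    rw [norm_expIntegrand z a ht]
  · simp only
    rw [← Real.exp_add]
    ring_nf

/-- On `t > 1` one has `e^{-at} ≤ e^{1-a} e^{-t}`, so the dependence on `a ≥ 1` is exponentially
small. -/
theorem integral_norm_expIntegrand_le (z : ℂ) {a : ℝ} (ha : 1 ≤ a) :
    ∫ t in Set.Ioi (1 : ℝ), ‖expIntegrand z a t‖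
      ≤ Real.exp (1 - a) * ∫ t in Set.Ioi (1 : ℝ), ‖expIntegrand z 1 t‖ := by
  rw [← MeasureTheory.integral_const_mul]
  refine MeasureTheory.setIntegral_mono_on (integrableOn_expIntegrand z (by linarith)).norm
    ((integrableOn_expIntegrand z one_pos).norm.const_mul _) measurableSet_Ioi fun t ht => ?_
  have ht : 1 < t := ht
  rw [norm_expIntegrand z a (by linarith), norm_expIntegrand z 1 (by linarith), mul_left_comm,
    ← Real.exp_add]
  gcongr
  nlinarith

theorem one_le_pi_mul_pnat_sq (n : ℕ+) : 1 ≤ Real.pi * (n : ℝ) ^ 2 := by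
  have h : (1 : ℝ) ≤ n := by exact_mod_cast n.pos
  nlinarith [Real.pi_gt_three]

theorem summable_integral_norm_expIntegrand (z : ℂ) :
    Summable fun n : ℕ+ => ∫ t in Set.Ioi (1 : ℝ), ‖expIntegrand z (Real.pi * (n : ℝ) ^ 2) t‖ := by
  have h := (hasSum_pnat_exp_neg_sq one_pos).summable.mul_left
    (Real.exp 1 * ∫ t in Set.Ioi (1 : ℝ), ‖expIntegrand z 1 t‖)
  refine h.of_nonneg_of_le (fun n => MeasureTheory.integral_nonneg fun t => norm_nonneg _)
    fun n => (integral_norm_expIntegrand_le z (one_le_pi_mul_pnat_sq n)).trans_eq ?_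
  rw [sub_eq_add_neg, Real.exp_add]
  ring_nf

/-- Integration by parts: `a E_z(a) = e^{-a} - z E_{z+1}(a)`. -/
theorem genExpIntegral_add_one (z : ℂ) {a : ℝ} (ha : 0 < a) :
    z * genExpIntegral (z + 1) a + a * genExpIntegral z a = (Real.exp (-a) : ℂ) := by
  have hd : ∀ t ∈ Set.Ici (1 : ℝ), HasDerivAt (expIntegrand z a)
      (-z * expIntegrand (z + 1) a t + -a * expIntegrand z a t) t := by
    intro t (ht : 1 ≤ t)
    have h0 : (t : ℂ) ∈ Complex.slitPlane := Complex.ofReal_mem_slitPlane.mpr (by linarith)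
    have h1 : HasDerivAt (fun t : ℝ => (t : ℂ) ^ (-z)) (-z * (t : ℂ) ^ (-z - 1)) t :=
      ((hasDerivAt_id (t : ℂ)).cpow_const h0).comp_ofReal.congr_deriv (by simp)
    have h2 : HasDerivAt (fun t : ℝ => (Real.exp (-(a * t)) : ℂ))
        (Real.exp (-(a * t)) * -a : ℝ) t :=
      HasDerivAt.ofReal_comp (by
        simpa using (((hasDerivAt_id t).const_mul a).fun_neg).exp)
    refine (h1.mul h2).congr_deriv ?_
    rw [expIntegrand, expIntegrand, show -(z + 1) = -z - 1 by ring]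
    push_cast
    ring
  have hi1 := (integrableOn_expIntegrand (z + 1) ha).const_mul (-z)
  have hi2 := (integrableOn_expIntegrand z ha).const_mul (-a : ℂ)
  have hi := MeasureTheory.Integrable.add hi1 hi2
  -- the boundary term at infinity vanishes, since function and derivative are both integrable
  have h0 := MeasureTheory.tendsto_zero_of_hasDerivAt_of_integrableOn_Ioi
    (fun t ht => hd t (Set.Ioi_subset_Ici_self ht)) hi (integrableOn_expIntegrand z ha)
  have h := MeasureTheory.integral_Ioi_of_hasDerivAt_of_tendsto' hd hi h0
  rw [MeasureTheory.integral_add hi1 hi2, MeasureTheory.integral_const_mul,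
    MeasureTheory.integral_const_mul] at h
  have e : expIntegrand z a 1 = (Real.exp (-a) : ℂ) := by simp [expIntegrand]
  rw [e] at h
  rw [genExpIntegral, genExpIntegral]
  linear_combination -h

/-! ### The completed zeta function as a series of exponential integrals -/

/-- The function whose Mellin transform at `s / 2` is `2 Λ₀(s)`: it is `θ₃(t) - 1` for `t > 1`,
`θ₃(t) - t^{-1/2}` for `0 < t < 1`, and `0` at `t = 1`. -/
noncomputable def modifiedThetaKernel : ℝ → ℂ := (HurwitzZeta.hurwitzEvenFEPair 0).f_modif

theorem modifiedThetaKernel_of_one_lt {t : ℝ} (ht : 1 < t) :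
    modifiedThetaKernel t = 2 * ∑' n : ℕ+, (Real.exp (-(Real.pi * (n : ℝ) ^ 2 * t)) : ℂ) := by
  have h0 : 0 < t := by linarith
  have h1 : HurwitzZeta.evenKernel 0 t = thetaThree t := by
    have := (HurwitzZeta.hasSum_int_evenKernel 0 h0).tsum_eq
    simp only [add_zero, QuotientAddGroup.mk_zero] at this
    exact this.symm
  have h2 := (hasSum_pnat_exp_neg_sq h0).tsum_eq
  rw [← Complex.ofReal_tsum, h2]
  simp [modifiedThetaKernel, WeakFEPair.f_modif, ht, ht.le, HurwitzZeta.hurwitzEvenFEPair, h1]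
  ring

theorem modifiedThetaKernel_inv {t : ℝ} (ht : 0 < t) :
    modifiedThetaKernel t⁻¹ = ((t ^ (1 / 2 : ℝ) : ℝ) : ℂ) * modifiedThetaKernel t := by
  have h := (HurwitzZeta.hurwitzEvenFEPair 0).toStrongFEPair.h_feq t ht
  simp only [WeakFEPair.toStrongFEPair, HurwitzZeta.hurwitzEvenFEPair_zero_symm] at h
  simpa [modifiedThetaKernel, HurwitzZeta.hurwitzEvenFEPair] using h

theorem mellinConvergent_modifiedThetaKernel (w : ℂ) : MellinConvergent modifiedThetaKernel w :=
  ((HurwitzZeta.hurwitzEvenFEPair 0).isStrongFEPair_toStrongFEPair.hasMellin w).1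

theorem completedRiemannZeta₀_eq_mellin (s : ℂ) :
    completedRiemannZeta₀ s = mellin modifiedThetaKernel (s / 2) / 2 := rfl

/-- Riemann's symmetrization: `t ↦ 1/t` folds the Mellin integral onto `t > 1`. -/
theorem mellin_modifiedThetaKernel (w : ℂ) :
    mellin modifiedThetaKernel w = mellin ((Set.Ioi 1).indicator modifiedThetaKernel) w
      + mellin ((Set.Ioi 1).indicator modifiedThetaKernel) (1 / 2 - w) := by
  have hc1 : MellinConvergent ((Set.Ioi 1).indicator modifiedThetaKernel) w := by
    have := (mellinConvergent_modifiedThetaKernel w).indicator (measurableSet_Ioi (a := 1))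
    refine MeasureTheory.Integrable.congr this (.of_forall fun t => ?_)
    simp only [Set.indicator]
    split_ifs <;> simp
  -- at `t = 1` both sides vanish because the kernel takes the value `0` there
  have h2 : ∀ t ∈ Set.Ioi (0 : ℝ), modifiedThetaKernel t
      - (Set.Ioi 1).indicator modifiedThetaKernel t
      = (t : ℂ) ^ (-(1 / 2) : ℂ) • (Set.Ioi 1).indicator modifiedThetaKernel t⁻¹ := by
    intro t (ht : 0 < t)
    have hp : ((t ^ (1 / 2 : ℝ) : ℝ) : ℂ) = (t : ℂ) ^ (1 / 2 : ℂ) := by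
      rw [Complex.ofReal_cpow ht.le]
      simp
    have hne : (t : ℂ) ^ (1 / 2 : ℂ) ≠ 0 := by
      rw [← hp]
      exact_mod_cast (Real.rpow_pos_of_pos ht _).ne'
    rcases lt_trichotomy t 1 with h | rfl | h
    · rw [Set.indicator_of_notMem (by simpa using h.le),
        Set.indicator_of_mem (Set.mem_Ioi.mpr ((one_lt_inv₀ ht).mpr h)),
        modifiedThetaKernel_inv ht, hp,
        Complex.cpow_neg, smul_eq_mul, sub_zero, inv_mul_cancel_left₀ hne]
    · simp [modifiedThetaKernel, WeakFEPair.f_modif]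
    · rw [Set.indicator_of_mem (Set.mem_Ioi.mpr h), Set.indicator_of_notMem (by
        simpa using inv_le_one_of_one_le₀ h.le), sub_self, smul_zero]
  have h3 : mellin (fun t => modifiedThetaKernel t - (Set.Ioi 1).indicator modifiedThetaKernel t) w
      = mellin ((Set.Ioi 1).indicator modifiedThetaKernel) (1 / 2 - w) := by
    rw [show (1 / 2 - w : ℂ) = -(w + -(1 / 2)) by ring, ← mellin_comp_inv, ← mellin_cpow_smul]
    refine MeasureTheory.setIntegral_congr_fun measurableSet_Ioi fun t ht => ?_
    exact congrArg ((t : ℂ) ^ (w - 1) • ·) (h2 t ht)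
  rw [← h3, (hasMellin_sub (mellinConvergent_modifiedThetaKernel w) hc1).2]
  ring

/-- Termwise integration of `t^{w-1} (θ₃(t) - 1)` over `t > 1`. -/
theorem hasSum_mellin_indicator_modifiedThetaKernel (w : ℂ) :
    HasSum (fun n : ℕ+ => genExpIntegral (1 - w) (Real.pi * (n : ℝ) ^ 2))
      (mellin ((Set.Ioi 1).indicator modifiedThetaKernel) w / 2) := by
  have h := MeasureTheory.hasSum_integral_of_summable_integral_norm
    (fun n : ℕ+ => integrableOn_expIntegrand (1 - w)
      (zero_lt_one.trans_le (one_le_pi_mul_pnat_sq n)))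
    (summable_integral_norm_expIntegrand (1 - w))
  have e : (fun t : ℝ => (t : ℂ) ^ (w - 1) • (Set.Ioi 1).indicator modifiedThetaKernel t)
      = (Set.Ioi 1).indicator (fun t : ℝ => (t : ℂ) ^ (w - 1) * modifiedThetaKernel t) := by
    funext t
    by_cases ht : t ∈ Set.Ioi (1 : ℝ) <;> simp [ht]
  have e' : mellin ((Set.Ioi 1).indicator modifiedThetaKernel) w / 2
      = ∫ t in Set.Ioi (1 : ℝ), (t : ℂ) ^ (w - 1) * modifiedThetaKernel t / 2 := by
    rw [mellin, e, MeasureTheory.setIntegral_indicator measurableSet_Ioi,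
      Set.inter_eq_self_of_subset_right (Set.Ioi_subset_Ioi zero_le_one),
      ← MeasureTheory.integral_div]
  rw [e']
  refine (congrArg (HasSum _) ?_).mp h
  refine MeasureTheory.setIntegral_congr_fun measurableSet_Ioi fun t ht => ?_
  simp only [expIntegrand]
  rw [modifiedThetaKernel_of_one_lt ht, tsum_mul_left, neg_sub]
  ring

/-- Riemann's formula for `Λ₀`, expanded termwise in exponential integrals. -/
theorem hasSum_completedRiemannZeta₀ (s : ℂ) :
    HasSum (fun n : ℕ+ => genExpIntegral (-s / 2 + 1) (Real.pi * (n : ℝ) ^ 2)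
      + genExpIntegral ((s - 1) / 2 + 1) (Real.pi * (n : ℝ) ^ 2)) (completedRiemannZeta₀ s) := by
  rw [completedRiemannZeta₀_eq_mellin, mellin_modifiedThetaKernel, add_div]
  have h := (hasSum_mellin_indicator_modifiedThetaKernel (s / 2)).add
    (hasSum_mellin_indicator_modifiedThetaKernel (1 / 2 - s / 2))
  rwa [show 1 - s / 2 = -s / 2 + 1 by ring,
    show 1 - (1 / 2 - s / 2) = (s - 1) / 2 + 1 by ring] at h

/-! ### The two series for `ξ` -/

theorem riemannXi_eq {s : ℂ} (hs0 : 0 < s.re) (hs1 : s.re < 1) :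
    riemannXi s = 1 / 2 + s * (s - 1) / 2 * completedRiemannZeta₀ s := by
  have h1 : 1 - s ≠ 0 := fun h => by
    have := congrArg Complex.re h
    simp at this
    linarith
  have h2 : Complex.Gamma (s / 2 + 1) ≠ 0 :=
    Complex.Gamma_ne_zero_of_re_pos (by simp; linarith)
  have h3 : (Real.pi : ℂ) ^ (-s / 2) ≠ 0 := by simp [Complex.cpow_eq_zero_iff, Real.pi_ne_zero]
  rw [riemannXi, riemannZeta_eq_mul_completedRiemannZeta₀, add_comm 1 (s / 2)]
  generalize Complex.Gamma (s / 2 + 1) = G at h2 ⊢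
  field_simp
  ring

/-- The series of exponential integrals, in the form obtained by one integration by parts. -/
theorem hasSum_sq_mul_genExpIntegral {s : ℂ} (hs0 : 0 < s.re) (hs1 : s.re < 1) :
    HasSum (fun n : ℕ+ => ((n : ℕ) : ℂ) ^ 2 *
        (s * genExpIntegral ((s - 1) / 2) (Real.pi * (n : ℝ) ^ 2) +
          (1 - s) * genExpIntegral (-s / 2) (Real.pi * (n : ℝ) ^ 2)))
      (((thetaThree 1 / 2 : ℝ) - riemannXi s) / Real.pi) := by
  have hpi : (Real.pi : ℂ) ≠ 0 := by exact_mod_cast Real.pi_ne_zero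
  have h1 := (hasSum_completedRiemannZeta₀ s).mul_left (s * (s - 1) / 2)
  have h2 := Complex.hasSum_ofReal.mpr (hasSum_pnat_exp_neg_sq one_pos)
  have e : ((thetaThree 1 / 2 : ℝ) - riemannXi s) / Real.pi
      = (((thetaThree 1 - 1) / 2 : ℝ) - s * (s - 1) / 2 * completedRiemannZeta₀ s) / Real.pi := by
    rw [riemannXi_eq hs0 hs1]
    push_cast
    ring
  rw [e]
  refine (congrArg (HasSum · _) (funext fun n => ?_)).mpr ((h2.sub h1).div_const (Real.pi : ℂ))
  have ha : 0 < Real.pi * (n : ℝ) ^ 2 := zero_lt_one.trans_le (one_le_pi_mul_pnat_sq n)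
  have e1 := genExpIntegral_add_one (-s / 2) ha
  have e2 := genExpIntegral_add_one ((s - 1) / 2) ha
  rw [mul_one, eq_div_iff hpi]
  push_cast at e1 e2 ⊢
  linear_combination (1 - s) * e1 + s * e2

theorem xiIntegrand_eq (s : ℂ) (n : ℕ) {t : ℝ} (ht : 0 < t) :
    xiIntegrand s n t = (n : ℂ) ^ 4 * (expIntegrand (-s / 2 - 1) (Real.pi * (n : ℝ) ^ 2) t
        + expIntegrand ((s - 1) / 2 - 1) (Real.pi * (n : ℝ) ^ 2) t)
      - 3 / (2 * Real.pi) * (n : ℂ) ^ 2 * (expIntegrand (-s / 2) (Real.pi * (n : ℝ) ^ 2) t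
        + expIntegrand ((s - 1) / 2) (Real.pi * (n : ℝ) ^ 2) t) := by
  have h0 : (t : ℂ) ≠ 0 := by exact_mod_cast ht.ne'
  simp only [xiIntegrand, expIntegrand]
  rw [show -(-s / 2 - 1) = s / 2 + 1 by ring, show -((s - 1) / 2 - 1) = (1 - s) / 2 + 1 by ring,
    show -(-s / 2) = s / 2 by ring, show -((s - 1) / 2) = (1 - s) / 2 by ring,
    Complex.cpow_add _ _ h0, Complex.cpow_add _ _ h0, Complex.cpow_one]
  push_cast
  ring

theorem integrableOn_xiIntegrand (s : ℂ) (n : ℕ+) :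
    MeasureTheory.IntegrableOn (xiIntegrand s n) (Set.Ioi (1 : ℝ)) := by
  have hi (z : ℂ) :=
    integrableOn_expIntegrand z (zero_lt_one.trans_le (one_le_pi_mul_pnat_sq n))
  have h := (((hi (-s / 2 - 1)).add (hi ((s - 1) / 2 - 1))).const_mul (((n : ℕ) : ℂ) ^ 4)).sub
    (((hi (-s / 2)).add (hi ((s - 1) / 2))).const_mul (3 / (2 * Real.pi) * ((n : ℕ) : ℂ) ^ 2))
  exact MeasureTheory.IntegrableOn.congr_fun h
    (fun t ht => (xiIntegrand_eq s n (zero_lt_one.trans ht)).symm) measurableSet_Ioi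

/-- Each integral of the first series in terms of exponential integrals: integration by parts
removes the extra factor `t` from the integrand. -/
theorem integral_xiIntegrand (s : ℂ) (n : ℕ+) :
    2 * (Real.pi : ℂ) ^ 2 * ∫ t in Set.Ioi (1 : ℝ), xiIntegrand s n t
      = (4 * Real.pi * ((n : ℝ) ^ 2 * Real.exp (-(Real.pi * (n : ℝ) ^ 2))) : ℝ)
        - Real.pi * (((n : ℕ) : ℂ) ^ 2 *
          (s * genExpIntegral ((s - 1) / 2) (Real.pi * (n : ℝ) ^ 2) +
            (1 - s) * genExpIntegral (-s / 2) (Real.pi * (n : ℝ) ^ 2))) := by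
  have hpi : (Real.pi : ℂ) ≠ 0 := by exact_mod_cast Real.pi_ne_zero
  have ha : 0 < Real.pi * (n : ℝ) ^ 2 := zero_lt_one.trans_le (one_le_pi_mul_pnat_sq n)
  have hi (z : ℂ) := integrableOn_expIntegrand z ha
  have hi1 := ((hi (-s / 2 - 1)).add (hi ((s - 1) / 2 - 1))).const_mul (((n : ℕ) : ℂ) ^ 4)
  have hi2 := ((hi (-s / 2)).add (hi ((s - 1) / 2))).const_mul
    (3 / (2 * Real.pi) * ((n : ℕ) : ℂ) ^ 2)
  rw [MeasureTheory.setIntegral_congr_fun measurableSet_Ioi fun t ht =>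
    xiIntegrand_eq s n (zero_lt_one.trans ht)]
  have e0 := MeasureTheory.integral_sub hi1 hi2
  rw [MeasureTheory.integral_const_mul, MeasureTheory.integral_const_mul] at e0
  have e1 := MeasureTheory.integral_add (hi (-s / 2 - 1)) (hi ((s - 1) / 2 - 1))
  have e2 := MeasureTheory.integral_add (hi (-s / 2)) (hi ((s - 1) / 2))
  simp only [Pi.add_apply] at e0 e1 e2
  rw [e0, e1, e2]
  have e3 := genExpIntegral_add_one (-s / 2 - 1) ha
  have e4 := genExpIntegral_add_one ((s - 1) / 2 - 1) ha
  rw [sub_add_cancel] at e3 e4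
  have e5 : 3 / (2 * (Real.pi : ℂ)) * (2 * Real.pi) = 3 := by field_simp
  push_cast at e3 e4 ⊢
  simp only [genExpIntegral] at e3 e4 ⊢
  linear_combination (2 * Real.pi * ((n : ℕ) : ℂ) ^ 2) * (e3 + e4) -
    (Real.pi * ((n : ℕ) : ℂ) ^ 2 *
      ((∫ t in Set.Ioi (1 : ℝ), expIntegrand (-s / 2) (Real.pi * (n : ℝ) ^ 2) t) +
        ∫ t in Set.Ioi (1 : ℝ), expIntegrand ((s - 1) / 2) (Real.pi * (n : ℝ) ^ 2) t)) * e5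

theorem corollary1 (s : ℂ) (hs0 : 0 < s.re) (hs1 : s.re < 1) :
    -- the integral representation, with convergence of its integrals and of its series
    ((∀ n : ℕ+, MeasureTheory.IntegrableOn (xiIntegrand s n) (Set.Ioi (1 : ℝ))) ∧
      Summable (fun n : ℕ+ => ∫ t in Set.Ioi (1 : ℝ), xiIntegrand s n t) ∧
      riemannXi s =
        2 * (Real.pi : ℂ) ^ 2 * ∑' n : ℕ+, ∫ t in Set.Ioi (1 : ℝ), xiIntegrand s n t) ∧
    -- the representation by exponential integrals, with convergence likewise
    ((∀ n : ℕ+,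
        MeasureTheory.IntegrableOn (expIntegrand ((s - 1) / 2) (Real.pi * (n : ℝ) ^ 2))
          (Set.Ioi (1 : ℝ)) ∧
        MeasureTheory.IntegrableOn (expIntegrand (-s / 2) (Real.pi * (n : ℝ) ^ 2))
          (Set.Ioi (1 : ℝ))) ∧
      Summable (fun n : ℕ+ => ((n : ℕ) : ℂ) ^ 2 *
        (s * genExpIntegral ((s - 1) / 2) (Real.pi * (n : ℝ) ^ 2) +
          (1 - s) * genExpIntegral (-s / 2) (Real.pi * (n : ℝ) ^ 2))) ∧
      riemannXi s =
        ((Real.pi ^ (1 / 4 : ℝ) / (2 * Real.Gamma (3 / 4)) : ℝ) : ℂ) -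
          (Real.pi : ℂ) * ∑' n : ℕ+, ((n : ℕ) : ℂ) ^ 2 *
            (s * genExpIntegral ((s - 1) / 2) (Real.pi * (n : ℝ) ^ 2) +
              (1 - s) * genExpIntegral (-s / 2) (Real.pi * (n : ℝ) ^ 2))) ∧
    -- the constant is the sum of the series `4 π ∑ n² e^{-π n²}`
    HasSum (fun n : ℕ+ => 4 * Real.pi * ((n : ℝ) ^ 2 * Real.exp (-(Real.pi * (n : ℝ) ^ 2))))
      (Real.pi ^ (1 / 4 : ℝ) / (2 * Real.Gamma (3 / 4))) := by
  have hconst : Real.pi ^ (1 / 4 : ℝ) / (2 * Real.Gamma (3 / 4)) = thetaThree 1 / 2 := by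
    rw [thetaThree_one, div_div, mul_comm (2 : ℝ)]
  have hpi : (Real.pi : ℂ) ≠ 0 := by exact_mod_cast Real.pi_ne_zero
  have hc := hasSum_four_pi_mul_sq_mul_exp
  have h2 := hasSum_sq_mul_genExpIntegral hs0 hs1
  have h1 : HasSum (fun n : ℕ+ => 2 * (Real.pi : ℂ) ^ 2 *
      ∫ t in Set.Ioi (1 : ℝ), xiIntegrand s n t) (riemannXi s) := by
    have h := (Complex.hasSum_ofReal.mpr hc).sub (h2.mul_left (Real.pi : ℂ))
    rw [mul_div_cancel₀ _ hpi, sub_sub_cancel] at h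
    exact (congrArg (HasSum · _) (funext fun n => (integral_xiIntegrand s n))).mpr h
  have hpos (n : ℕ+) : 0 < Real.pi * (n : ℝ) ^ 2 :=
    zero_lt_one.trans_le (one_le_pi_mul_pnat_sq n)
  rw [hconst]
  refine ⟨⟨fun n => integrableOn_xiIntegrand s n, ?_, ?_⟩,
    ⟨fun n => ⟨integrableOn_expIntegrand _ (hpos n), integrableOn_expIntegrand _ (hpos n)⟩,
      h2.summable, ?_⟩, hc⟩
  · exact (summable_mul_left_iff (by simp)).mp h1.summable
  · rw [← tsum_mul_left, h1.tsum_eq]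
  · rw [h2.tsum_eq, mul_div_cancel₀ _ hpi, sub_sub_cancel]
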